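/- **Definitions.** Let $x_1,\dots,x_n\in\mathbb R^d$, $C=\operatorname{cone}(x_1,\dots,x_n)=\mathbb R_+x_1+\dots+\mathbb R_+x_n$ and $C_i=\operatorname{cone}(x_1,\dots,x_i)$. The dimension of a cone is the dimension of its linear span. A *triangulation of a cone $D$ with rays in a set $X$* is a finite set $\Sigma$ of cones with union $D$, each generated by a linearly independent subset of $X$, such that faces of members of $\Sigma$ belong to $\Sigma$ and the intersection of any two members is a face of both. For a set $\Sigma$ of cones and a cone $C'$ the restriction $\Sigma|C'$ consists of the cones $\sigma\cap C'$ with $\sigma\in\Sigma$ and $\dim(\sigma\cap C')=\dim C'$, together with all their faces. We say that $\Sigma$ *restricts to a triangulation of $C'$ with rays in $X$* if $\Sigma|C'$ is a triangulation of $C'$ with rays in $X$ and $\Sigma|C'\subseteq\Sigma$ (so that $\Sigma$ extends $\Sigma|C'$). The lexicographic (placing) triangulation $\Lambda(x_1,\dots,x_n)$ is defined recursively: for $n=0$ it is $\{\{0\}\}$, and $$\Lambda(x_1,\dots,x_n)=\Lambda(x_1,\dots,x_{n-1})\cup\{\operatorname{cone}(\sigma,x_n):\sigma\in\Lambda(x_1,\dots,x_{n-1})\text{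 visible from }x_n\},$$ where $\sigma$ is visible from $x_n$ if $x_n\notin C_{n-1}$ and for every $y\in\sigma$ the segment $[x_n,y]$ meets $C_{n-1}$ only in $y$. Put $\Lambda=\Lambda(x_1,\dots,x_n)$. **Proposition 2.1.** 1. $\Lambda$ is the unique triangulation of $C$ with rays in $\{x_1,\dots,x_n\}$ that, for every $i=1,\dots,n$, restricts to a triangulation of $C_i$ with rays in $\{x_1,\dots,x_i\}$. 2. For every face $F$ of $C$ one has $\Lambda|F=\Lambda(x_{i_1},\dots,x_{i_m})$, where $i_1<\dots<i_m$ are the indices $i$ with $x_i\in F$. 3. If $2\le i\le n$ and $\dim C_i>\dim C_{i-1}$, then $\Lambda=\Lambda(x_1,\dots,x_{i-2},x_i,x_{i-1},x_{i+1},\dots,x_n)$. 4. Let $r=\dim C$. Among the index vectors $(i_1,\dots,i_r)$ with $i_1<\dots<i_r$ for which $x_{i_1},\dots,x_{i_r}$ are linearly independent there is a lexicographically smallest one, and for it $\Lambda=\Lambda(x_{i_1},\dots,x_{i_r},x_{j_1},\dots,x_{j_{n-r}})$, where $j_1<\dots<j_{n-r}$ are the complementary indices. -/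

import Mathlib

namespace LexTriangulation

variable {E : Type*} [AddCommGroup E] [Module ℝ E]

/-- The dimension of a cone: the dimension of its linear span. -/
noncomputable def coneDim (C : PointedCone ℝ E) : ℕ :=
  Module.finrank ℝ (Submodule.span ℝ (C : Set E))

/-- `S` is a triangulation of the cone `C` with rays through a subset of `X`: a finite set of
simplicial cones generated by linearly independent subsets of `X`, closed under passage to
faces, such that any two of them intersect in a common face and their union is `C`. -/
structure IsTriangulation (X : Set E) (C : PointedCone ℝ E) (S : Set (PointedCone ℝ E)) :
    Prop where
  finite : S.Finite
  simplicial : ∀ σ ∈ S, ∃ s ⊆ X, LinearIndepOn ℝ id s ∧ σ = PointedCone.hull ℝ s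
  face_mem : ∀ σ ∈ S, ∀ τ : PointedCone ℝ E, τ.IsFaceOf σ → τ ∈ S
  inter_face : ∀ σ ∈ S, ∀ τ ∈ S, (σ ⊓ τ).IsFaceOf σ ∧ (σ ⊓ τ).IsFaceOf τ
  cover : (⋃ σ ∈ S, (σ : Set E)) = (C : Set E)

/-- The restriction `S|C'`. Its maximal cones are the intersections `σ ∩ C'` with `σ ∈ S` and
`dim (σ ∩ C') = dim C'`; as for every polyhedral complex, the faces of these belong to it. -/
def restriction (S : Set (PointedCone ℝ E)) (C' : PointedCone ℝ E) : Set (PointedCone ℝ E) :=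
  {τ | ∃ σ ∈ S, coneDim (σ ⊓ C') = coneDim C' ∧ τ.IsFaceOf (σ ⊓ C')}

/-- `S` restricts to a triangulation of `C'` with rays through a subset of `X`: the restriction
is such a triangulation, and it is a subcomplex of `S`, so that `S` extends it. -/
def RestrictsToTriangulation (S : Set (PointedCone ℝ E)) (X : Set E) (C' : PointedCone ℝ E) :
    Prop :=
  restriction S C' ⊆ S ∧ IsTriangulation X C' (restriction S C')

/-- The cone `σ` is visible from `x` with respect to the cone `C`. -/
def Visible (C : PointedCone ℝ E) (x : E) (σ : PointedCone ℝ E) : Prop :=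
  x ∉ C ∧ ∀ y ∈ σ, segment ℝ x y ∩ (C : Set E) = {y}

/-- The lexicographic (or placing) triangulation `Λ(x_1, …, x_n)`. -/
def lexTriangulation : {n : ℕ} → (Fin n → E) → Set (PointedCone ℝ E)
  | 0, _ => {⊥}
  | n + 1, x =>
    lexTriangulation (Fin.init x) ∪
      {τ | ∃ σ ∈ lexTriangulation (Fin.init x),
        Visible (PointedCone.hull ℝ (Set.range (Fin.init x))) (x (Fin.last n)) σ ∧
          τ = σ ⊔ PointedCone.hull ℝ {x (Fin.last n)}}

/-- The set `{x_1, …, x_i}` of the first `i` generators. -/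
def firstGenerators {n : ℕ} (x : Fin n → E) (i : ℕ) : Set E :=
  x '' {j | (j : ℕ) < i}

/-- The cone `C_i` generated by `x_1, …, x_i`. -/
def initialCone {n : ℕ} (x : Fin n → E) (i : ℕ) : PointedCone ℝ E :=
  PointedCone.hull ℝ (firstGenerators x i)

/-- The subfamily `x_{i_1}, …, x_{i_m}`, where `i_1 < ⋯ < i_m` are the elements of `T`. -/
noncomputable def subfamily {n : ℕ} (x : Fin n → E) (T : Set (Fin n)) :
    Fin T.toFinite.toFinset.card → E :=
  fun k => x (T.toFinite.toFinset.orderEmbOfFin rfl k)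

/-- The index vectors `(i_1, …, i_r)` with `i_1 < ⋯ < i_r` of linearly independent
subfamilies `x_{i_1}, …, x_{i_r}`. -/
def independentIndexVectors {n : ℕ} (x : Fin n → E) (r : ℕ) : Set (Fin r → Fin n) :=
  {s | StrictMono s ∧ LinearIndependent ℝ (x ∘ s)}

end LexTriangulation

/-!
# The lexicographic triangulation

The recursive step of the lexicographic triangulation is isolated as `place C T x`. A member `σ` of
a triangulation of `C` is visible from `x ∉ C` if and only if `y + ε x ∉ C` for all `y ∈ σ` and
`ε > 0` (`visible_iff`); everything about visibility is deduced from this form.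

* If `T` triangulates `C`, then `place C T x` triangulates `C + ℝ₊ x` (`IsTriangulation.place`).
  Points outside `C` are covered because moving in direction `-x` until `C` is reached ends in a
  visible point; visibility also makes the coefficient of `x` in a point of `σ + ℝ₊ x` unique,
  which gives the intersection property.
* A triangulation of a subcone `C'` that is contained in a triangulation `S` consists of *all*
  members of `S` inside `C'` (`IsTriangulation.mem_of_le`), and it equals the restriction `S|C'`
  (`IsTriangulation.restriction_eq`), since triangulations of cones are pure
  (`IsTriangulation.exists_full`). So restricting to a triangulation of `C'` means containing one.
* For uniqueness, a triangulation of `C + ℝ₊ x` that contains a triangulation `T` of `C` has only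
  members of `T` and cones `σ + ℝ₊ x` with `σ ∈ T`, where `σ` has to be visible. It is therefore
  contained in `place C T x`, and one triangulation of a cone contained in another one is equal
  to it (`IsTriangulation.eq_place`).
* For a face `F` of `C`, the members inside `F` triangulate `F`, and they arise by placing only the
  vectors in `F`, since `y + ε x ∈ C` is equivalent to `y + ε x ∈ C ∩ F` for `x` and `y` in `F`.
* If `b` lies outside the span of `C` and `a`, everything is visible from `b`, and adding the
  direction `b` does not affect what is visible from `a`. Hence the steps for `a` and `b` commute
  (`place_comm`).
* The lexicographically smallest basis consists of the vectors outside the span of their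
  predecessors. By exchange steps these can be moved in front of all the others.

The last three points are carried out with lists of vectors, in the order of placement reversed
(`listTriangulation`), so that the vector placed last is the head of the list.
-/

namespace LexTriangulation

/-! ### Faces and relative interiors of cones -/

section Algebra

variable {E : Type*} [AddCommGroup E] [Module ℝ E]

theorem exists_sub_of_mem_span {C : PointedCone ℝ E} {z : E}
    (hz : z ∈ Submodule.span ℝ (C : Set E)) : ∃ a ∈ C, ∃ b ∈ C, z = a - b := by
  induction hz using Submodule.span_induction with
  | mem u hu => exact ⟨u, hu, 0, C.zero_mem, by simp⟩
  | zero => exact ⟨0, C.zero_mem, 0, C.zero_mem, by simp⟩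
  | add u v _ _ hu hv =>
    obtain ⟨a, ha, b, hb, rfl⟩ := hu
    obtain ⟨a', ha', b', hb', rfl⟩ := hv
    exact ⟨a + a', C.add_mem ha ha', b + b', C.add_mem hb hb', by abel⟩
  | smul r u _ hu =>
    obtain ⟨a, ha, b, hb, rfl⟩ := hu
    rcases le_total 0 r with hr | hr
    · exact ⟨r • a, C.smul_mem hr ha, r • b, C.smul_mem hr hb, smul_sub ..⟩
    · refine ⟨(-r) • b, C.smul_mem (neg_nonneg.2 hr) hb, (-r) • a,
        C.smul_mem (neg_nonneg.2 hr) ha, ?_⟩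
      module

/-- A face is the intersection of the cone with the linear span of the face. -/
theorem mem_of_mem_span_face {F C : PointedCone ℝ E} (hF : F.IsFaceOf C) {z : E} (hz : z ∈ C)
    (hzF : z ∈ Submodule.span ℝ (F : Set E)) : z ∈ F := by
  obtain ⟨a, ha, b, hb, rfl⟩ := exists_sub_of_mem_span hzF
  exact hF.mem_of_add_mem_left hz (hF.le hb) (by simpa using ha)

/-- The point `v` lies in the relative interior of the cone `C`, encoded facially: `C` is the
only face of `C` that contains `v`. -/
def IsRelInterior (v : E) (C : PointedCone ℝ E) : Prop :=
  v ∈ C ∧ ∀ F : PointedCone ℝ E, F.IsFaceOf C → v ∈ F → F = C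

theorem exists_isRelInterior_hull {s : Set E} (hs : s.Finite) :
    ∃ v, IsRelInterior v (PointedCone.hull ℝ s) := by
  have := hs.fintype
  refine ⟨∑ i : s, (i : E), Submodule.sum_mem _ fun i _ => PointedCone.subset_hull i.2,
    fun F hF hv => le_antisymm hF.le (Submodule.span_le.2 fun u hu => ?_)⟩
  exact hF.mem_of_sum_mem (f := fun i : s => (i : E)) (fun i => PointedCone.subset_hull i.2) hv
    ⟨u, hu⟩

/-- Every point of a cone lies in the relative interior of some face, namely of the smallest
face that contains it. -/
theorem exists_face_isRelInterior {C : PointedCone ℝ E} {y : E} (hy : y ∈ C) :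
    ∃ F : PointedCone ℝ E, F.IsFaceOf C ∧ IsRelInterior y F := by
  refine ⟨C ⊓ sInf {F | F.IsFaceOf C ∧ y ∈ F}, PointedCone.IsFaceOf.sInf _ fun F hF => hF.1,
    ⟨hy, ?_⟩, fun G hG hyG => le_antisymm hG.le ?_⟩
  · exact Submodule.mem_sInf.2 fun F hF => hF.2
  · have hGC := hG.trans (PointedCone.IsFaceOf.sInf _ fun F hF => hF.1)
    exact inf_le_right.trans (sInf_le ⟨hGC, hyG⟩)

theorem IsRelInterior.add_mem {C : PointedCone ℝ E} {v u : E} (hv : IsRelInterior v C)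
    (hu : u ∈ C) : IsRelInterior (v + u) C :=
  ⟨C.add_mem hv.1 hu, fun F hF h => hv.2 F hF (hF.mem_of_add_mem_left hv.1 hu h)⟩

/-- From a point in the relative interior one can move a little away from any given point of the
cone without leaving the cone. -/
theorem IsRelInterior.exists_sub_smul_mem {C : PointedCone ℝ E} {v u : E}
    (hv : IsRelInterior v C) (hu : u ∈ C) : ∃ δ : ℝ, 0 < δ ∧ v - δ • u ∈ C := by
  -- The points with this property form a face that contains `v`.
  let G : PointedCone ℝ E := PointedCone.ofConeComb {u | u ∈ C ∧ ∃ δ : ℝ, 0 < δ ∧ v - δ • u ∈ C}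
    ⟨0, C.zero_mem, 1, one_pos, by simpa using hv.1⟩ (by
      rintro u ⟨hu, δ, hδ, hδu⟩ w ⟨hw, η, hη, hηw⟩ a ha b hb
      refine ⟨C.add_mem (C.smul_mem ha hu) (C.smul_mem hb hw), (a / δ + b / η + 1)⁻¹,
        by positivity, ?_⟩
      have hpos : 0 < a / δ + b / η + 1 := by positivity
      have h := C.smul_mem (inv_nonneg.2 hpos.le) (C.add_mem (C.add_mem
        (C.smul_mem (div_nonneg ha hδ.le) hδu) (C.smul_mem (div_nonneg hb hη.le) hηw)) hv.1)
      convert h using 1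
      rw [eq_inv_smul_iff₀ hpos.ne', smul_sub, smul_inv_smul₀ hpos.ne']
      match_scalars <;> field_simp)
  have hG : G.IsFaceOf C := by
    refine ⟨fun u hu => hu.1, ?_⟩
    rintro u w a hu hw ha ⟨-, δ, hδ, h⟩
    refine ⟨hu, δ * a, mul_pos hδ ha, ?_⟩
    have := C.add_mem h (C.smul_mem hδ.le hw)
    convert this using 1
    module
  have hGC : G = C := hv.2 G hG ⟨hv.1, 1, one_pos, by simp⟩
  rw [← hGC] at hu
  exact hu.2

theorem mem_sup_ray {σ : PointedCone ℝ E} {x z : E} :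
    z ∈ σ ⊔ PointedCone.hull ℝ {x} ↔ ∃ y ∈ σ, ∃ t : ℝ, 0 ≤ t ∧ y + t • x = z := by
  simp only [Submodule.mem_sup, Submodule.mem_span_singleton]
  constructor
  · rintro ⟨y, hy, _, ⟨t, rfl⟩, rfl⟩
    exact ⟨y, hy, t, t.2, rfl⟩
  · rintro ⟨y, hy, t, ht, rfl⟩
    exact ⟨y, hy, _, ⟨⟨t, ht⟩, rfl⟩, rfl⟩

theorem mem_sup_ray_self {σ : PointedCone ℝ E} {x : E} : x ∈ σ ⊔ PointedCone.hull ℝ {x} :=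
  le_sup_right (a := σ) (PointedCone.subset_hull rfl)

theorem hull_insert (x : E) (s : Set E) :
    PointedCone.hull ℝ (insert x s) = PointedCone.hull ℝ s ⊔ PointedCone.hull ℝ {x} := by
  rw [PointedCone.hull, Submodule.span_insert, sup_comm]

theorem span_hull (s : Set E) :
    Submodule.span ℝ (PointedCone.hull ℝ s : Set E) = Submodule.span ℝ s :=
  le_antisymm (Submodule.span_le.2 (PointedCone.hull_le_span ℝ s))
    (Submodule.span_mono PointedCone.subset_hull)

/-- In `σ + ℝ₊ x` with `x` outside the span of `σ`, the coefficient of `x` is unique. -/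
theorem coeff_unique {V : Submodule ℝ E} {x : E} (hx : x ∉ V) {y y' : E} (hy : y ∈ V)
    (hy' : y' ∈ V) {t t' : ℝ} (h : y + t • x = y' + t' • x) : t = t' ∧ y = y' := by
  have ht : t = t' := by
    by_contra hne
    apply hx
    have h1 : (t - t') • x = y' - y := by
      rw [sub_smul, sub_eq_sub_iff_add_eq_add, add_comm, h, add_comm]
    rw [← inv_smul_smul₀ (sub_ne_zero.2 hne) x, h1]
    exact V.smul_mem _ (V.sub_mem hy' hy)
  subst ht
  exact ⟨rfl, add_right_cancel h⟩

theorem sup_ray_face_sup_ray {ρ σ : PointedCone ℝ E} {x : E} (h : ρ.IsFaceOf σ)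
    (hx : x ∉ Submodule.span ℝ (σ : Set E)) :
    (ρ ⊔ PointedCone.hull ℝ {x}).IsFaceOf (σ ⊔ PointedCone.hull ℝ {x}) := by
  refine PointedCone.IsFaceOf.of_mem_of_add_mem_left (sup_le_sup_right h.le _) ?_
  intro u w hu hw huw
  obtain ⟨y, hy, t, ht, rfl⟩ := mem_sup_ray.1 hu
  obtain ⟨y', hy', t', ht', rfl⟩ := mem_sup_ray.1 hw
  obtain ⟨z, hz, r, hr, h'⟩ := mem_sup_ray.1 huw
  have h2 : z + r • x = (y + y') + (t + t') • x := by rw [h']; module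
  have hyy := (coeff_unique hx (Submodule.subset_span (h.le hz))
    (Submodule.subset_span (σ.add_mem hy hy')) h2).2
  exact mem_sup_ray.2 ⟨y, h.mem_of_add_mem_left hy hy' (hyy ▸ hz), t, ht, rfl⟩

theorem face_sup_ray {σ : PointedCone ℝ E} {x : E} (hx : x ∉ Submodule.span ℝ (σ : Set E)) :
    σ.IsFaceOf (σ ⊔ PointedCone.hull ℝ {x}) := by
  refine PointedCone.IsFaceOf.of_mem_of_add_mem_left le_sup_left ?_
  intro u w hu hw huw
  obtain ⟨y, hy, t, ht, rfl⟩ := mem_sup_ray.1 hu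
  obtain ⟨y', hy', t', ht', rfl⟩ := mem_sup_ray.1 hw
  have h2 : (y + y') + (t + t') • x = (y + t • x + (y' + t' • x)) + (0 : ℝ) • x := by module
  have ht0 := (coeff_unique hx (Submodule.subset_span (σ.add_mem hy hy'))
    (Submodule.subset_span huw) h2).1
  have : t = 0 := by linarith
  simpa [this] using hy

/-- A face of `σ + ℝ₊ x` is either a face of `σ` or of the form `ρ + ℝ₊ x` for a face `ρ`
of `σ`. -/
theorem face_of_sup_ray {τ σ : PointedCone ℝ E} {x : E}
    (h : τ.IsFaceOf (σ ⊔ PointedCone.hull ℝ {x})) :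
    τ.IsFaceOf σ ∨ ∃ ρ : PointedCone ℝ E, ρ.IsFaceOf σ ∧ τ = ρ ⊔ PointedCone.hull ℝ {x} := by
  have hface : (τ ⊓ σ).IsFaceOf σ := by
    simpa using h.inf (PointedCone.IsFaceOf.refl σ)
  by_cases hx : x ∈ τ
  · refine Or.inr ⟨τ ⊓ σ, hface, le_antisymm (fun z hz => ?_)
      (sup_le inf_le_left (Submodule.span_le.2 (by simpa using hx)))⟩
    obtain ⟨y, hy, t, ht, rfl⟩ := mem_sup_ray.1 (h.le hz)
    refine mem_sup_ray.2 ⟨y, ⟨?_, hy⟩, t, ht, rfl⟩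
    exact h.mem_of_add_mem_left (le_sup_left (b := PointedCone.hull ℝ {x}) hy)
      (PointedCone.smul_mem _ ht mem_sup_ray_self) hz
  · refine Or.inl ?_
    have hle : τ ≤ σ := by
      intro z hz
      obtain ⟨y, hy, t, ht, rfl⟩ := mem_sup_ray.1 (h.le hz)
      rcases ht.eq_or_lt with rfl | ht
      · simpa using hy
      · refine absurd (h.mem_of_smul_add_mem mem_sup_ray_self
          (le_sup_left (b := PointedCone.hull ℝ {x}) hy) ht ?_) hx
        rwa [add_comm]
    rwa [inf_eq_left.2 hle] at hface

/-- A cone that is not contained in any of finitely many subspaces has a point that avoids all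
of them. -/
theorem exists_mem_forall_notMem (C : PointedCone ℝ E) {𝒱 : Set (Submodule ℝ E)}
    (h𝒱 : 𝒱.Finite) (h : ∀ V ∈ 𝒱, ¬ (C : Set E) ⊆ V) : ∃ w ∈ C, ∀ V ∈ 𝒱, w ∉ V := by
  induction 𝒱, h𝒱 using Set.Finite.induction_on with
  | empty => exact ⟨0, C.zero_mem, by simp⟩
  | @insert V 𝒱 hV h𝒱 ih =>
    obtain ⟨w, hw, hw𝒱⟩ := ih fun U hU => h U (Set.mem_insert_of_mem _ hU)
    obtain ⟨u, hu, huV⟩ := Set.not_subset.1 (h V (Set.mem_insert _ _))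
    -- Each of the subspaces contains `w + t u` for at most one value of `t`.
    have hsub : ∀ U ∈ insert V 𝒱, {t : ℝ | w + t • u ∈ U}.Subsingleton := by
      intro U hU t ht t' ht'
      by_contra hne
      have h1 : (t - t') • u ∈ U := by
        have := U.sub_mem ht ht'
        convert this using 1
        module
      have h2 : u ∈ U := (U.smul_mem_iff (sub_ne_zero.2 hne)).1 h1
      rcases hU with rfl | hU
      · exact huV h2
      · exact hw𝒱 U hU (by simpa using U.sub_mem ht (U.smul_mem t h2))
    have hfin : (⋃ U ∈ insert V 𝒱, {t : ℝ | w + t • u ∈ U}).Finite :=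
      (h𝒱.insert V).biUnion fun U hU => (hsub U hU).finite
    obtain ⟨t, ht, htU⟩ := (Set.Ioi_infinite (0 : ℝ)).exists_notMem_finite hfin
    refine ⟨w + t • u, C.add_mem hw (C.smul_mem (le_of_lt ht) hu), fun U hU hmem => htU ?_⟩
    exact Set.mem_biUnion hU hmem

/-- A point `y` is seen from `x` if and only if no proper translate `y + ε x` lies in `C`. -/
theorem visible_iff {C σ : PointedCone ℝ E} {x : E} (hσ : σ ≤ C) :
    Visible C x σ ↔ x ∉ C ∧ ∀ y ∈ σ, ∀ ε : ℝ, 0 < ε → y + ε • x ∉ C := by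
  refine and_congr_right fun hx => forall₂_congr fun y hy => ⟨fun h ε hε hmem => ?_, fun h => ?_⟩
  · have hpos : 0 < 1 + ε := by positivity
    have h1 : (1 + ε)⁻¹ • (y + ε • x) ∈ segment ℝ x y ∩ (C : Set E) := by
      refine ⟨⟨ε / (1 + ε), 1 / (1 + ε), by positivity, by positivity, by field_simp; ring, ?_⟩,
        C.smul_mem (inv_nonneg.2 hpos.le) hmem⟩
      match_scalars <;> field_simp
    rw [h, Set.mem_singleton_iff, inv_smul_eq_iff₀ hpos.ne', add_smul, one_smul,
      add_right_inj] at h1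
    exact hx (smul_right_injective E hε.ne' h1 ▸ hσ hy)
  · refine Set.Subset.antisymm ?_ (Set.singleton_subset_iff.2 ⟨right_mem_segment ℝ x y, hσ hy⟩)
    rintro _ ⟨⟨a, b, ha, hb, hab, rfl⟩, hmem⟩
    rcases ha.eq_or_lt with rfl | ha
    · simp [show b = 1 by linarith]
    rcases hb.eq_or_lt with rfl | hb
    · exact absurd (by simpa [show a = 1 by linarith] using hmem) hx
    · refine absurd (C.smul_mem (inv_nonneg.2 hb.le) hmem) ?_
      convert h (a / b) (by positivity) using 2
      match_scalars <;> field_simp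

theorem Visible.mono {C σ τ : PointedCone ℝ E} {x : E} (h : Visible C x σ) (hτ : τ ≤ σ) :
    Visible C x τ :=
  ⟨h.1, fun y hy => h.2 y (hτ hy)⟩

/-! ### Restrictions of triangulations -/

variable {X : Set E} {C : PointedCone ℝ E} {S T : Set (PointedCone ℝ E)}

theorem IsTriangulation.le (hT : IsTriangulation X C T) {σ : PointedCone ℝ E} (hσ : σ ∈ T) :
    σ ≤ C := by
  intro z hz
  rw [← SetLike.mem_coe, ← hT.cover]
  exact Set.mem_biUnion hσ hz

theorem IsTriangulation.exists_mem (hT : IsTriangulation X C T) {z : E} (hz : z ∈ C) :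
    ∃ σ ∈ T, z ∈ σ := by
  rw [← SetLike.mem_coe, ← hT.cover] at hz
  simpa using hz

/-- A member of a triangulation with a relative interior point in another member is a face
of it. -/
theorem IsTriangulation.face_of_isRelInterior (hS : IsTriangulation X C S)
    {σ τ : PointedCone ℝ E} (hσ : σ ∈ S) (hτ : τ ∈ S) {v : E} (hv : IsRelInterior v τ)
    (hvσ : v ∈ σ) : τ.IsFaceOf σ := by
  have h := hS.inter_face σ hσ τ hτ
  have h1 : σ ⊓ τ = τ := hv.2 _ h.2 ⟨hvσ, hv.1⟩
  exact h1 ▸ h.1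

end Algebra

section Topology

variable {E : Type*} [NormedAddCommGroup E] [NormedSpace ℝ E]

theorem isClosed_hull_of_linearIndepOn {s : Set E} (hs : s.Finite)
    (hli : LinearIndepOn ℝ id s) : IsClosed (PointedCone.hull ℝ s : Set E) := by
  have := hs.fintype
  let f : (s → ℝ) →ₗ[ℝ] E := Fintype.linearCombination ℝ (fun i : s => (i : E))
  have hf : Function.Injective f := hli.fintypeLinearCombination_injective
  have hcl := (LinearMap.isClosedEmbedding_of_injective (LinearMap.ker_eq_bot.2 hf)).isClosedMap
    _ (isClosed_Ici (a := (0 : s → ℝ)))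
  convert hcl using 1
  ext z
  have hrange : PointedCone.hull ℝ s = Submodule.span _ (Set.range fun i : s => (i : E)) := by
    rw [Subtype.range_coe]
  rw [SetLike.mem_coe, hrange, Submodule.mem_span_range_iff_exists_fun, Set.mem_image]
  constructor
  · rintro ⟨c, rfl⟩
    exact ⟨fun i => c i, fun i => (c i).2, rfl⟩
  · rintro ⟨c, hc, rfl⟩
    exact ⟨fun i => ⟨c i, hc i⟩, rfl⟩

variable [FiniteDimensional ℝ E] {X X' : Set E} {C C' : PointedCone ℝ E}
  {S T : Set (PointedCone ℝ E)}

theorem IsTriangulation.exists_finite_simplicial (hT : IsTriangulation X C T)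
    {σ : PointedCone ℝ E} (hσ : σ ∈ T) :
    ∃ s ⊆ X, s.Finite ∧ LinearIndepOn ℝ id s ∧ σ = PointedCone.hull ℝ s := by
  obtain ⟨s, hs, hli, rfl⟩ := hT.simplicial σ hσ
  exact ⟨s, hs, hli.setFinite, hli, rfl⟩

theorem IsTriangulation.isClosed_mem (hT : IsTriangulation X C T) {σ : PointedCone ℝ E}
    (hσ : σ ∈ T) : IsClosed (σ : Set E) := by
  obtain ⟨s, -, hs, hli, rfl⟩ := hT.exists_finite_simplicial hσ
  exact isClosed_hull_of_linearIndepOn hs hli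

theorem IsTriangulation.isClosed (hT : IsTriangulation X C T) : IsClosed (C : Set E) := by
  rw [← hT.cover]
  exact hT.finite.isClosed_biUnion fun σ hσ => hT.isClosed_mem hσ

theorem IsTriangulation.exists_isRelInterior (hT : IsTriangulation X C T) {σ : PointedCone ℝ E}
    (hσ : σ ∈ T) : ∃ v, IsRelInterior v σ := by
  obtain ⟨s, -, hs, -, rfl⟩ := hT.exists_finite_simplicial hσ
  exact exists_isRelInterior_hull hs

/-- A subcomplex that triangulates a subcone consists of all members contained in the subcone. -/
theorem IsTriangulation.mem_of_le (hS : IsTriangulation X C S) (hT : IsTriangulation X' C' T)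
    (hTS : T ⊆ S) {ρ : PointedCone ℝ E} (hρ : ρ ∈ S) (hρC : ρ ≤ C') : ρ ∈ T := by
  obtain ⟨v, hv⟩ := hS.exists_isRelInterior hρ
  obtain ⟨τ, hτ, hvτ⟩ := hT.exists_mem (hρC hv.1)
  exact hT.face_mem τ hτ ρ (hS.face_of_isRelInterior (hTS hτ) hρ hv hvτ)

/-- Two triangulations of the same cone, one contained in the other, are equal. -/
theorem IsTriangulation.eq_of_subset (hS : IsTriangulation X C S) (hT : IsTriangulation X' C T)
    (hTS : T ⊆ S) : T = S :=
  hTS.antisymm fun _ hρ => hS.mem_of_le hT hTS hρ (hS.le hρ)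

/-- Triangulations are pure: every member is a face of a member that spans the same space as
the whole cone. -/
theorem IsTriangulation.exists_full (hT : IsTriangulation X C T) {τ : PointedCone ℝ E}
    (hτ : τ ∈ T) : ∃ σ ∈ T, τ.IsFaceOf σ ∧ (C : Set E) ⊆ Submodule.span ℝ (σ : Set E) := by
  obtain ⟨v, hv⟩ := hT.exists_isRelInterior hτ
  -- Move from `v` a little in a direction `w` outside all smaller subspaces `span σ`.
  obtain ⟨w, hw, hwV⟩ := exists_mem_forall_notMem C
    (𝒱 := (fun σ : PointedCone ℝ E => Submodule.span ℝ (σ : Set E)) ''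
      {σ ∈ T | ¬ (C : Set E) ⊆ Submodule.span ℝ (σ : Set E)})
    ((hT.finite.subset (Set.sep_subset _ _)).image _) (by rintro _ ⟨σ, hσ, rfl⟩; exact hσ.2)
  have hcl : IsClosed (⋃ σ ∈ {σ ∈ T | v ∉ σ}, (σ : Set E)) :=
    (hT.finite.subset (Set.sep_subset _ _)).isClosed_biUnion fun σ hσ => hT.isClosed_mem hσ.1
  have hnhds : ∀ᶠ ε : ℝ in nhdsWithin 0 (Set.Ioi 0),
      v + ε • w ∉ ⋃ σ ∈ {σ ∈ T | v ∉ σ}, (σ : Set E) := by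
    have hcont : Filter.Tendsto (fun ε : ℝ => v + ε • w) (nhds 0) (nhds v) := by
      have : Continuous fun ε : ℝ => v + ε • w := by fun_prop
      simpa using this.tendsto 0
    exact (hcont.mono_left nhdsWithin_le_nhds).eventually
      (hcl.isOpen_compl.mem_nhds (by simp))
  obtain ⟨ε, hε, hε0⟩ := (hnhds.and self_mem_nhdsWithin).exists
  obtain ⟨σ, hσ, hmem⟩ := hT.exists_mem (C.add_mem (hT.le hτ hv.1) (C.smul_mem (le_of_lt hε0) hw))
  have hvσ : v ∈ σ := by
    by_contra hvσ
    exact hε (Set.mem_biUnion (show σ ∈ {σ ∈ T | v ∉ σ} from ⟨hσ, hvσ⟩) hmem)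
  refine ⟨σ, hσ, hT.face_of_isRelInterior hσ hτ hv hvσ, ?_⟩
  by_contra hspan
  refine hwV _ ⟨σ, ⟨hσ, hspan⟩, rfl⟩ ?_
  have h1 : ε • w ∈ Submodule.span ℝ (σ : Set E) := by
    have := Submodule.sub_mem _ (Submodule.subset_span (R := ℝ) hmem)
      (Submodule.subset_span (R := ℝ) hvσ)
    simpa using this
  exact (Submodule.smul_mem_iff _ (ne_of_gt hε0)).1 h1

theorem coneDim_eq_iff (h : C' ≤ C) :
    coneDim C' = coneDim C ↔ (C : Set E) ⊆ Submodule.span ℝ (C' : Set E) := by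
  rw [← Submodule.span_le]
  constructor
  · intro heq
    exact (Submodule.eq_of_le_of_finrank_eq (Submodule.span_mono h) heq).ge
  · intro hle
    unfold coneDim
    rw [le_antisymm hle (Submodule.span_mono h)]

/-- The restriction of a triangulation to a subcone triangulated by a subcomplex is that
subcomplex. -/
theorem IsTriangulation.restriction_eq (hS : IsTriangulation X C S)
    (hT : IsTriangulation X' C' T) (hTS : T ⊆ S) : restriction S C' = T := by
  ext ρ
  constructor
  · rintro ⟨σ, hσ, hdim, hρ⟩
    rw [coneDim_eq_iff inf_le_right] at hdim
    suffices σ ⊓ C' ∈ T from hT.face_mem _ this _ hρ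
    -- A general point `w` of `σ ∩ C'` lies only in members of `T` of full dimension.
    obtain ⟨w, hw, hwV⟩ := exists_mem_forall_notMem (σ ⊓ C')
      (𝒱 := (fun τ : PointedCone ℝ E => Submodule.span ℝ (τ : Set E)) ''
        {τ ∈ T | ¬ ((σ ⊓ C' : PointedCone ℝ E) : Set E) ⊆ Submodule.span ℝ (τ : Set E)})
      ((hT.finite.subset (Set.sep_subset _ _)).image _) (by rintro _ ⟨τ, hτ, rfl⟩; exact hτ.2)
    obtain ⟨τ, hτ, hwτ⟩ := hT.exists_mem hw.2
    have hface := hS.inter_face σ hσ τ (hTS hτ)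
    have hmem : σ ⊓ τ ∈ T := hT.face_mem τ hτ _ hface.2
    have hspan : ((σ ⊓ C' : PointedCone ℝ E) : Set E) ⊆
        Submodule.span ℝ ((σ ⊓ τ : PointedCone ℝ E) : Set E) := by
      by_contra hcon
      exact hwV _ ⟨_, ⟨hmem, hcon⟩, rfl⟩ (Submodule.subset_span ⟨hw.1, hwτ⟩)
    have heq : σ ⊓ τ = σ ⊓ C' := by
      refine le_antisymm (inf_le_inf_left _ (hT.le hτ)) fun z hz => ?_
      exact mem_of_mem_span_face hface.1 hz.1 (hspan hz)
    exact heq ▸ hmem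
  · intro hρ
    obtain ⟨σ, hσ, hface, hspan⟩ := hT.exists_full hρ
    have hinf : σ ⊓ C' = σ := inf_eq_left.2 (hT.le hσ)
    refine ⟨σ, hTS hσ, ?_, hinf.symm ▸ hface⟩
    rw [hinf, coneDim_eq_iff (hT.le hσ)]
    exact hspan

end Topology

/-! ### Placing one more vector -/

/-- One step of the lexicographic triangulation: the vector `x` is added to the set `T` of cones
subdividing `C`, by joining it to all members of `T` that are visible from it. -/
def place {E : Type*} [AddCommGroup E] [Module ℝ E] (C : PointedCone ℝ E)
    (T : Set (PointedCone ℝ E)) (x : E) : Set (PointedCone ℝ E) :=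
  T ∪ {τ | ∃ σ ∈ T, Visible C x σ ∧ τ = σ ⊔ PointedCone.hull ℝ {x}}

theorem range_eq_insert_init {α : Type*} {n : ℕ} (x : Fin (n + 1) → α) :
    Set.range x = insert (x (Fin.last n)) (Set.range (Fin.init x)) := by
  ext z
  simp only [Set.mem_range, Fin.exists_fin_succ', Set.mem_insert_iff, Fin.init, or_comm, eq_comm]

theorem firstGenerators_self {E : Type*} {n : ℕ} (x : Fin n → E) : firstGenerators x n = Set.range x := by
  simp [firstGenerators]

theorem firstGenerators_init {E : Type*} {n : ℕ} (x : Fin (n + 1) → E) {i : ℕ} (hi : i ≤ n) :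
    firstGenerators (Fin.init x) i = firstGenerators x i := by
  ext z
  simp only [firstGenerators, Set.mem_image, Set.mem_ofPred_eq, Fin.exists_fin_succ', Fin.init,
    Fin.val_castSucc, Fin.val_last]
  refine ⟨Or.inl, ?_⟩
  rintro (h | h)
  · exact h
  · omega

section Algebra

variable {E : Type*} [AddCommGroup E] [Module ℝ E] {C σ τ ρ : PointedCone ℝ E} {x : E}

theorem subset_place (C : PointedCone ℝ E) (T : Set (PointedCone ℝ E)) (x : E) :
    T ⊆ place C T x :=
  Set.subset_union_left

theorem lexTriangulation_succ {n : ℕ} (x : Fin (n + 1) → E) :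
    lexTriangulation x = place (PointedCone.hull ℝ (Set.range (Fin.init x)))
      (lexTriangulation (Fin.init x)) (x (Fin.last n)) :=
  rfl

/-- A point of the cone over a visible part of `C` that lies in `C` already lies in that part. -/
theorem Visible.coeff_eq_zero (h : Visible C x σ) (hσ : σ ≤ C) {y : E} (hy : y ∈ σ) {t : ℝ}
    (ht : 0 ≤ t) (hmem : y + t • x ∈ C) : t = 0 := by
  by_contra hne
  exact ((visible_iff hσ).1 h).2 y hy t (lt_of_le_of_ne ht (Ne.symm hne)) hmem

theorem Visible.inf_sup_ray (h : Visible C x σ) (hσ : σ ≤ C) (hτ : τ ≤ C) :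
    τ ⊓ (σ ⊔ PointedCone.hull ℝ {x}) = τ ⊓ σ := by
  refine le_antisymm (fun z hz => ⟨hz.1, ?_⟩) (inf_le_inf_left _ le_sup_left)
  obtain ⟨y, hy, t, ht, rfl⟩ := mem_sup_ray.1 hz.2
  have := h.coeff_eq_zero hσ hy ht (hτ hz.1)
  simpa [this] using hy

theorem Visible.sup_ray_inf_sup_ray (hσv : Visible C x σ) (hσ : σ ≤ C) (hτv : Visible C x τ)
    (hτ : τ ≤ C) :
    (σ ⊔ PointedCone.hull ℝ {x}) ⊓ (τ ⊔ PointedCone.hull ℝ {x}) =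
      (σ ⊓ τ) ⊔ PointedCone.hull ℝ {x} := by
  refine le_antisymm (fun z hz => ?_)
    (le_inf (sup_le_sup_right inf_le_left _) (sup_le_sup_right inf_le_right _))
  obtain ⟨y, hy, t, ht, rfl⟩ := mem_sup_ray.1 hz.1
  obtain ⟨y', hy', t', ht', heq⟩ := mem_sup_ray.1 hz.2
  have key : ∀ {a b : E} {r s : ℝ}, a + r • x = b + s • x → r ≤ s → b + (s - r) • x = a := by
    intro a b r s h _
    rw [sub_smul, ← add_sub_assoc, ← h, add_sub_cancel_right]
  have htt : t = t' := by
    rcases le_total t t' with hle | hle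
    · have := hτv.coeff_eq_zero hτ hy' (sub_nonneg.2 hle) (key heq.symm hle ▸ hσ hy)
      linarith
    · have := hσv.coeff_eq_zero hσ hy (sub_nonneg.2 hle) (key heq hle ▸ hτ hy')
      linarith
  subst htt
  rw [add_left_inj] at heq
  exact mem_sup_ray.2 ⟨y, ⟨hy, heq ▸ hy'⟩, t, ht, rfl⟩

/-- A vector from which a cone with relative interior is visible lies outside its span. -/
theorem Visible.notMem_span (h : Visible C x σ) (hσ : σ ≤ C) {v : E} (hv : IsRelInterior v σ) :
    x ∉ Submodule.span ℝ (σ : Set E) := by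
  intro hx
  obtain ⟨a, ha, b, hb, rfl⟩ := exists_sub_of_mem_span hx
  obtain ⟨δ, hδ, hmem⟩ := hv.exists_sub_smul_mem hb
  refine ((visible_iff hσ).1 h).2 v hv.1 δ hδ (hσ ?_)
  have := σ.add_mem hmem (σ.smul_mem hδ.le ha)
  convert this using 1
  module

theorem initialCone_init {n : ℕ} (x : Fin (n + 1) → E) {i : ℕ} (hi : i ≤ n) :
    initialCone (Fin.init x) i = initialCone x i := by
  rw [initialCone, initialCone, firstGenerators_init x hi]

theorem bot_face_hull {s : Set E} (hs : s.Finite) (hli : LinearIndepOn ℝ id s) :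
    (⊥ : PointedCone ℝ E).IsFaceOf (PointedCone.hull ℝ s) := by
  induction s, hs using Set.Finite.induction_on with
  | empty => simp
  | @insert x s hx _ ih =>
    have hx' : x ∉ Submodule.span ℝ (PointedCone.hull ℝ s : Set E) := by
      rw [span_hull]
      simpa using hli.notMem_span_of_insert hx
    rw [hull_insert]
    exact (ih (hli.mono (Set.subset_insert _ _))).trans (face_sup_ray hx')

theorem isTriangulation_bot (X : Set E) : IsTriangulation X (⊥ : PointedCone ℝ E) {⊥} where
  finite := Set.finite_singleton _
  simplicial := by
    rintro _ rfl
    exact ⟨∅, Set.empty_subset _, linearIndepOn_empty _ _, Submodule.span_empty.symm⟩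
  face_mem := by
    rintro _ rfl τ hτ
    exact le_bot_iff.1 hτ.le
  inter_face := by
    rintro _ rfl _ rfl
    simp
  cover := by simp

end Algebra

section Topology

variable {E : Type*} [NormedAddCommGroup E] [NormedSpace ℝ E] [FiniteDimensional ℝ E]
  {X : Set E} {C : PointedCone ℝ E} {T : Set (PointedCone ℝ E)}

theorem IsTriangulation.bot_mem (hT : IsTriangulation X C T) : ⊥ ∈ T := by
  obtain ⟨σ, hσ, -⟩ := hT.exists_mem (Submodule.zero_mem _)
  obtain ⟨s, -, hs, hli, rfl⟩ := hT.exists_finite_simplicial hσ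
  exact hT.face_mem _ hσ ⊥ (bot_face_hull hs hli)

theorem IsTriangulation.notMem_span_of_visible (hT : IsTriangulation X C T)
    {σ : PointedCone ℝ E} (hσ : σ ∈ T) {x : E} (h : Visible C x σ) :
    x ∉ Submodule.span ℝ (σ : Set E) := by
  obtain ⟨v, hv⟩ := hT.exists_isRelInterior hσ
  exact h.notMem_span (hT.le hσ) hv

/-- Every point of `C + ℝ₊ x` outside `C` lies on a ray from a visible point: move from it in
direction `-x` until `C` is reached. -/
theorem IsTriangulation.exists_visible (hT : IsTriangulation X C T) {x z : E}
    (hz : z ∈ C ⊔ PointedCone.hull ℝ {x}) (hzC : z ∉ C) :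
    ∃ σ ∈ T, Visible C x σ ∧ z ∈ σ ⊔ PointedCone.hull ℝ {x} := by
  have hx : x ∉ C := by
    intro hx
    obtain ⟨y, hy, t, ht, rfl⟩ := mem_sup_ray.1 hz
    exact hzC (C.add_mem hy (C.smul_mem ht hx))
  let A : Set ℝ := {t | 0 ≤ t ∧ z - t • x ∈ C}
  have hA : IsClosed A := by
    refine isClosed_Ici.inter (hT.isClosed.preimage (f := fun t : ℝ => z - t • x) ?_)
    fun_prop
  have hbdd : BddBelow A := ⟨0, fun t ht => ht.1⟩
  have hne : A.Nonempty := by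
    obtain ⟨y, hy, t, ht, rfl⟩ := mem_sup_ray.1 hz
    exact ⟨t, ht, by simpa using hy⟩
  obtain ⟨ht, hy⟩ := hA.csInf_mem hne hbdd
  set t := sInf A with ht_def
  have hvis : ∀ ε : ℝ, 0 < ε → z - t • x + ε • x ∉ C := by
    intro ε hε hmem
    rcases le_or_gt ε t with hle | hlt
    · have : t ≤ t - ε := by
        refine csInf_le hbdd ⟨by linarith, ?_⟩
        convert hmem using 1
        module
      linarith
    · -- Here `z` is a convex combination of two points of `C`.
      apply hzC
      have := C.add_mem (C.smul_mem (div_nonneg ht hε.le) hmem)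
        (C.smul_mem (div_nonneg (sub_nonneg.2 hlt.le) hε.le) hy)
      convert this using 1
      match_scalars <;> field_simp <;> ring
  obtain ⟨σ, hσ, hyσ⟩ := hT.exists_mem hy
  obtain ⟨F, hF, hyF⟩ := exists_face_isRelInterior hyσ
  have hFT := hT.face_mem σ hσ F hF
  refine ⟨F, hFT, (visible_iff (hT.le hFT)).2 ⟨hx, fun u hu ε hε hmem => ?_⟩,
    mem_sup_ray.2 ⟨_, hyF.1, t, ht, by simp⟩⟩
  obtain ⟨δ, hδ, hmem'⟩ := hyF.exists_sub_smul_mem hu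
  refine hvis (δ * ε) (mul_pos hδ hε) ?_
  have := C.add_mem (hT.le hFT hmem') (C.smul_mem hδ.le hmem)
  convert this using 1
  module

/-- Placing a vector extends a triangulation of `C` to one of `C + ℝ₊ x`. -/
theorem IsTriangulation.place (hT : IsTriangulation X C T) (x : E) :
    IsTriangulation (insert x X) (C ⊔ PointedCone.hull ℝ {x}) (place C T x) where
  finite := by
    refine hT.finite.union ((hT.finite.image fun σ => σ ⊔ PointedCone.hull ℝ {x}).subset ?_)
    rintro _ ⟨σ, hσ, -, rfl⟩
    exact ⟨σ, hσ, rfl⟩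
  simplicial := by
    rintro _ (hτ | ⟨σ, hσ, hvis, rfl⟩)
    · obtain ⟨s, hs, hli, rfl⟩ := hT.simplicial _ hτ
      exact ⟨s, hs.trans (Set.subset_insert _ _), hli, rfl⟩
    · have hx := hT.notMem_span_of_visible hσ hvis
      obtain ⟨s, hs, hli, rfl⟩ := hT.simplicial _ hσ
      rw [span_hull] at hx
      exact ⟨insert x s, Set.insert_subset_insert hs, hli.id_insert hx,
        (hull_insert x s).symm⟩
  face_mem := by
    rintro _ (hτ | ⟨σ, hσ, hvis, rfl⟩) ρ hρ
    · exact Or.inl (hT.face_mem _ hτ _ hρ)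
    · rcases face_of_sup_ray hρ with h | ⟨π, hπ, rfl⟩
      · exact Or.inl (hT.face_mem _ hσ _ h)
      · exact Or.inr ⟨π, hT.face_mem _ hσ _ hπ, hvis.mono hπ.le, rfl⟩
  inter_face := by
    have key : ∀ τ ∈ T, ∀ σ ∈ T, Visible C x σ →
        (τ ⊓ (σ ⊔ PointedCone.hull ℝ {x})).IsFaceOf τ ∧
          (τ ⊓ (σ ⊔ PointedCone.hull ℝ {x})).IsFaceOf (σ ⊔ PointedCone.hull ℝ {x}) := by
      intro τ hτ σ hσ hvis
      rw [hvis.inf_sup_ray (hT.le hσ) (hT.le hτ)]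
      have h := hT.inter_face τ hτ σ hσ
      exact ⟨h.1, h.2.trans (face_sup_ray (hT.notMem_span_of_visible hσ hvis))⟩
    rintro _ (hτ | ⟨σ, hσ, hvis, rfl⟩) _ (hτ' | ⟨σ', hσ', hvis', rfl⟩)
    · exact hT.inter_face _ hτ _ hτ'
    · exact key _ hτ _ hσ' hvis'
    · rw [inf_comm]
      exact (key _ hτ' _ hσ hvis).symm
    · rw [hvis.sup_ray_inf_sup_ray (hT.le hσ) hvis' (hT.le hσ')]
      have h := hT.inter_face σ hσ σ' hσ'
      exact ⟨sup_ray_face_sup_ray h.1 (hT.notMem_span_of_visible hσ hvis),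
        sup_ray_face_sup_ray h.2 (hT.notMem_span_of_visible hσ' hvis')⟩
  cover := by
    refine Set.Subset.antisymm (Set.iUnion₂_subset ?_) fun z hz => ?_
    · rintro _ (hτ | ⟨σ, hσ, -, rfl⟩)
      · exact (hT.le hτ).trans le_sup_left
      · exact sup_le_sup_right (hT.le hσ) _
    · by_cases hzC : z ∈ C
      · obtain ⟨σ, hσ, hzσ⟩ := hT.exists_mem hzC
        exact Set.mem_biUnion (subset_place C T x hσ) hzσ
      · obtain ⟨σ, hσ, hvis, hzσ⟩ := hT.exists_visible hz hzC
        exact Set.mem_biUnion (Or.inr ⟨σ, hσ, hvis, rfl⟩) hzσ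

theorem isTriangulation_lexTriangulation {n : ℕ} (x : Fin n → E) :
    IsTriangulation (Set.range x) (PointedCone.hull ℝ (Set.range x)) (lexTriangulation x) := by
  induction n with
  | zero =>
    have h : PointedCone.hull ℝ (Set.range x) = ⊥ := by simp [Set.range_eq_empty]
    rw [h]
    exact isTriangulation_bot _
  | succ n ih =>
    rw [lexTriangulation_succ, range_eq_insert_init, hull_insert]
    exact (ih (Fin.init x)).place _

/-! ### Characterization by restrictions to the initial cones -/

theorem exists_subset_lexTriangulation {n : ℕ} (x : Fin n → E) {i : ℕ} (hi : i ≤ n) :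
    ∃ T ⊆ lexTriangulation x, IsTriangulation (firstGenerators x i) (initialCone x i) T := by
  induction n with
  | zero =>
    obtain rfl : i = 0 := by omega
    refine ⟨_, subset_rfl, ?_⟩
    rw [initialCone, firstGenerators_self]
    exact isTriangulation_lexTriangulation x
  | succ n ih =>
    rcases hi.eq_or_lt with rfl | hlt
    · refine ⟨_, subset_rfl, ?_⟩
      rw [initialCone, firstGenerators_self]
      exact isTriangulation_lexTriangulation x
    · have hi' : i ≤ n := by omega
      obtain ⟨T, hT, htri⟩ := ih (Fin.init x) hi'
      rw [firstGenerators_init x hi', initialCone_init x hi'] at htri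
      exact ⟨T, hT.trans (subset_place _ _ _), htri⟩

/-- A triangulation of `C + ℝ₊ x` extending a triangulation `T` of `C` can only be obtained by
placing `x`. -/
theorem IsTriangulation.eq_place {S : Set (PointedCone ℝ E)} {x : E}
    (hT : IsTriangulation X C T) (hXC : X ⊆ C)
    (hS : IsTriangulation (insert x X) (C ⊔ PointedCone.hull ℝ {x}) S)
    (hTS : T ⊆ S) : S = LexTriangulation.place C T x := by
  refine (hT.place x).eq_of_subset hS fun ρ hρ => ?_
  by_cases hρC : ρ ≤ C
  · exact Or.inl (hS.mem_of_le hT hTS hρ hρC)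
  right
  obtain ⟨s, hs, hli, hρs⟩ := hS.simplicial ρ hρ
  have hxs : x ∈ s := by
    by_contra hxs
    refine hρC (hρs ▸ Submodule.span_le.2 fun y hy => ?_)
    rcases hs hy with rfl | hyX
    · exact absurd hy hxs
    · exact hXC hyX
  set σ := PointedCone.hull ℝ (s \ {x}) with hσ_def
  have hρσ : ρ = σ ⊔ PointedCone.hull ℝ {x} := by
    rw [hρs, hσ_def, ← hull_insert, Set.insert_sdiff_singleton, Set.insert_eq_of_mem hxs]
  have hxσ : x ∉ Submodule.span ℝ (σ : Set E) := by
    rw [hσ_def, span_hull]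
    have hli' : LinearIndepOn ℝ id (insert x (s \ {x})) := by
      rwa [Set.insert_sdiff_singleton, Set.insert_eq_of_mem hxs]
    simpa using hli'.notMem_span_of_insert (by simp)
  have hσC : σ ≤ C := by
    refine Submodule.span_le.2 fun y hy => hXC ?_
    exact (hs hy.1).resolve_left hy.2
  have hσS : σ ∈ S := hS.face_mem ρ hρ σ (hρσ ▸ face_sup_ray hxσ)
  refine ⟨σ, hS.mem_of_le hT hTS hσS hσC, (visible_iff hσC).2 ⟨fun hx => ?_, ?_⟩, hρσ⟩
  · exact hρC (hρσ ▸ sup_le hσC (Submodule.span_le.2 (by simpa using hx)))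
  · -- Otherwise some point of `C` would lie in the relative interior of `ρ`.
    intro y hy ε hε hmem
    obtain ⟨v, hv⟩ := hS.exists_isRelInterior hρ
    obtain ⟨u, hu, t, ht, rfl⟩ := mem_sup_ray.1 (hρσ ▸ hv.1)
    have hρy : (t / ε) • y ∈ ρ := by
      rw [hρσ]
      exact PointedCone.smul_mem _ (div_nonneg ht hε.le)
        (le_sup_left (b := PointedCone.hull ℝ {x}) hy)
    have hCmem : u + t • x + (t / ε) • y ∈ C := by
      have := C.add_mem (hσC hu) (C.smul_mem (div_nonneg ht hε.le) hmem)
      convert this using 1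
      match_scalars <;> field_simp
    obtain ⟨τ, hτ, hmemτ⟩ := hT.exists_mem hCmem
    have hface := hS.face_of_isRelInterior (hTS hτ) hρ (hv.add_mem hρy) hmemτ
    exact hρC (hface.le.trans (hT.le hτ))

/-- Uniqueness of the lexicographic triangulation, in terms of subcomplexes. -/
theorem IsTriangulation.eq_lexTriangulation {n : ℕ} {x : Fin n → E} {S : Set (PointedCone ℝ E)}
    (hS : IsTriangulation (Set.range x) (PointedCone.hull ℝ (Set.range x)) S)
    (h : ∀ i ≤ n, ∃ T ⊆ S, IsTriangulation (firstGenerators x i) (initialCone x i) T) :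
    S = lexTriangulation x := by
  induction n generalizing S with
  | zero =>
    exact (hS.eq_of_subset (isTriangulation_lexTriangulation x)
      (Set.singleton_subset_iff.2 hS.bot_mem)).symm
  | succ n ih =>
    obtain ⟨T, hTS, hT⟩ := h n n.le_succ
    rw [← initialCone_init x le_rfl, ← firstGenerators_init x le_rfl, initialCone,
      firstGenerators_self] at hT
    have hTlex : T = lexTriangulation (Fin.init x) := by
      refine ih hT fun i hi => ?_
      obtain ⟨T', hTS', hT'⟩ := h i (by omega)
      rw [← initialCone_init x hi, ← firstGenerators_init x hi] at hT'
      refine ⟨T', fun ρ hρ => hS.mem_of_le hT hTS (hTS' hρ) ((hT'.le hρ).trans ?_), hT'⟩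
      exact Submodule.span_mono (Set.image_subset_range _ _)
    rw [range_eq_insert_init, hull_insert] at hS
    rw [lexTriangulation_succ, ← hTlex]
    exact hT.eq_place PointedCone.subset_hull hS hTS

theorem restrictsToTriangulation_iff {X X' : Set E} {C' : PointedCone ℝ E}
    {S : Set (PointedCone ℝ E)} (hS : IsTriangulation X C S) :
    RestrictsToTriangulation S X' C' ↔ ∃ T ⊆ S, IsTriangulation X' C' T := by
  refine ⟨fun h => ⟨_, h.1, h.2⟩, ?_⟩
  rintro ⟨T, hTS, hT⟩
  have := hS.restriction_eq hT hTS
  exact ⟨this ▸ hTS, this ▸ hT⟩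

theorem eq_lexTriangulation_iff {n : ℕ} (x : Fin n → E) (S : Set (PointedCone ℝ E)) :
    (IsTriangulation (Set.range x) (PointedCone.hull ℝ (Set.range x)) S ∧
        ∀ i : ℕ, 1 ≤ i → i ≤ n →
          RestrictsToTriangulation S (firstGenerators x i) (initialCone x i)) ↔
      S = lexTriangulation x := by
  constructor
  · rintro ⟨hS, h⟩
    refine hS.eq_lexTriangulation fun i hi => ?_
    rcases Nat.eq_zero_or_pos i with rfl | hpos
    · have hbot : initialCone x 0 = ⊥ := by simp [initialCone, firstGenerators]
      exact ⟨{⊥}, Set.singleton_subset_iff.2 hS.bot_mem, by rw [hbot]; exact isTriangulation_bot _⟩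
    · exact (restrictsToTriangulation_iff hS).1 (h i hpos hi)
  · rintro rfl
    have htri := isTriangulation_lexTriangulation x
    exact ⟨htri, fun i _ hi =>
      (restrictsToTriangulation_iff htri).2 (exists_subset_lexTriangulation x hi)⟩

end Topology

/-! ### Lexicographic triangulations of lists -/

/-- The lexicographic triangulation of a list of vectors, which are placed from the last entry of
the list to the first. -/
def listTriangulation {E : Type*} [AddCommGroup E] [Module ℝ E] :
    List E → Set (PointedCone ℝ E)
  | [] => {⊥}
  | x :: l => place (PointedCone.hull ℝ {y | y ∈ l}) (listTriangulation l) x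

theorem setOf_mem_cons {α : Type*} (a : α) (l : List α) :
    {y | y ∈ a :: l} = insert a {y | y ∈ l} := by
  ext; simp

theorem ofFn_orderEmbOfFin {n k : ℕ} (s : Finset (Fin n)) (h : s.card = k) :
    List.ofFn (s.orderEmbOfFin h) = (List.finRange n).filter (· ∈ s) := by
  rw [List.ofFn_eq_map, Finset.listMap_orderEmbOfFin_finRange]
  refine List.Pairwise.eq_of_mem_iff (r := (· < ·)) s.sortedLT_sort.pairwise
    ((List.pairwise_lt_finRange n).filter _) fun a => ?_
  simp

open scoped Classical in
theorem ofFn_subfamily {E : Type*} {n : ℕ} (x : Fin n → E) (T : Set (Fin n)) :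
    List.ofFn (subfamily x T) = ((List.finRange n).filter (· ∈ T)).map x := by
  unfold subfamily
  rw [← Function.comp_def x, ← List.map_ofFn, ofFn_orderEmbOfFin]
  simp

theorem firstGenerators_succ {E : Type*} {n : ℕ} (x : Fin n → E) (j : Fin n) :
    firstGenerators x (j + 1) = insert (x j) (firstGenerators x j) := by
  rw [firstGenerators, firstGenerators, ← Set.image_insert_eq]
  congr 1
  ext k
  simp only [Set.mem_ofPred_eq, Set.mem_insert_iff, Fin.ext_iff]
  omega

section Algebra

variable {E : Type*} [AddCommGroup E] [Module ℝ E]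

theorem lexTriangulation_eq_list {n : ℕ} (x : Fin n → E) :
    lexTriangulation x = listTriangulation (List.ofFn x).reverse := by
  induction n with
  | zero => simp [lexTriangulation, listTriangulation]
  | succ n ih =>
    rw [lexTriangulation_succ, ih, List.ofFn_succ_last, List.reverse_concat, listTriangulation]
    congr 2
    ext z
    simp [Fin.init_def, List.mem_ofFn]

theorem listTriangulation_le {l : List E} {σ : PointedCone ℝ E} (hσ : σ ∈ listTriangulation l) :
    σ ≤ PointedCone.hull ℝ {y | y ∈ l} := by
  induction l generalizing σ with
  | nil => exact (Set.mem_singleton_iff.1 hσ).le.trans bot_le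
  | cons x l ih =>
    rw [setOf_mem_cons, hull_insert]
    rcases hσ with hσ | ⟨ρ, hρ, -, rfl⟩
    · exact (ih hσ).trans le_sup_left
    · exact sup_le_sup_right (ih hρ) _

/-! ### Faces -/

/-- A face is generated by the generators that it contains. -/
theorem face_eq_hull_inter {s : Set E} {F : PointedCone ℝ E}
    (hF : F.IsFaceOf (PointedCone.hull ℝ s)) : F = PointedCone.hull ℝ (s ∩ F) := by
  classical
  refine le_antisymm (fun z hz => ?_) (Submodule.span_le.2 Set.inter_subset_right)
  obtain ⟨c, hc, hc0, rfl⟩ := PointedCone.mem_hull_set.1 (hF.le hz)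
  refine Submodule.sum_mem _ fun y hy => ?_
  refine PointedCone.smul_mem _ (hc0 y) (PointedCone.subset_hull ⟨hc hy, ?_⟩)
  have hpos : 0 < c y := lt_of_le_of_ne (hc0 y) (Finsupp.mem_support_iff.1 hy).symm
  rw [Finsupp.sum, ← Finset.add_sum_erase _ _ hy] at hz
  refine hF.mem_of_smul_add_mem (PointedCone.subset_hull (hc hy)) ?_ hpos hz
  exact Submodule.sum_mem _ fun u hu => PointedCone.smul_mem _ (hc0 u)
    (PointedCone.subset_hull (hc (Finset.mem_of_mem_erase hu)))

/-- For a vector in a face `F` the visible parts of `C` and of `C ∩ F` agree. -/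
theorem visible_inf_iff {C F σ : PointedCone ℝ E} {x : E} (hx : x ∈ F) (hσ : σ ≤ C)
    (hσF : σ ≤ F) : Visible (C ⊓ F) x σ ↔ Visible C x σ := by
  rw [visible_iff hσ, visible_iff (le_inf hσ hσF)]
  refine and_congr (by simp [hx]) (forall₂_congr fun y hy => forall₂_congr fun ε hε => ?_)
  have : y + ε • x ∈ F := F.add_mem (hσF hy) (F.smul_mem hε.le hx)
  simp [this]

open scoped Classical in
theorem listTriangulation_filter_face {l : List E} {F : PointedCone ℝ E}
    (hF : F.IsFaceOf (PointedCone.hull ℝ {y | y ∈ l})) :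
    {σ ∈ listTriangulation l | σ ≤ F} = listTriangulation (l.filter (· ∈ F)) := by
  suffices h : ∀ l' : List E, l' <:+ l →
      {σ ∈ listTriangulation l' | σ ≤ F} = listTriangulation (l'.filter (· ∈ F)) from
    h l (List.suffix_refl l)
  intro l'
  induction l' with
  | nil =>
    intro _
    ext σ
    simp only [listTriangulation, List.filter_nil, Set.mem_ofPred_eq, Set.mem_singleton_iff]
    exact ⟨fun h => h.1, fun h => ⟨h, h ▸ bot_le⟩⟩
  | cons x l' ih =>
    intro hl
    have ih := ih ((List.suffix_cons x l').trans hl)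
    by_cases hx : x ∈ F
    · set C := PointedCone.hull ℝ {y | y ∈ l'} with hC
      have hCle : C ≤ PointedCone.hull ℝ {y | y ∈ l} :=
        Submodule.span_mono fun y hy => hl.subset (List.mem_cons_of_mem x hy)
      have hface : (C ⊓ F).IsFaceOf C := by
        have := (PointedCone.IsFaceOf.refl C).inf hF
        rwa [inf_eq_left.2 hCle] at this
      have hfilter : {y | y ∈ l'.filter (· ∈ F)} = {y | y ∈ l'} ∩ ((C ⊓ F : PointedCone ℝ E) :
          Set E) := by
        ext y
        simp only [List.mem_filter, decide_eq_true_eq, Set.mem_inter_iff, SetLike.mem_coe,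
          Submodule.mem_inf, Set.mem_ofPred_eq]
        exact ⟨fun h => ⟨h.1, PointedCone.subset_hull h.1, h.2⟩, fun h => ⟨h.1, h.2.2⟩⟩
      rw [List.filter_cons_of_pos (by simpa using hx), listTriangulation, listTriangulation,
        ← ih, hfilter, ← face_eq_hull_inter hface]
      ext σ
      constructor
      · rintro ⟨hσ | ⟨ρ, hρ, hvis, rfl⟩, hσF⟩
        · exact Or.inl ⟨hσ, hσF⟩
        · have hρF := le_sup_left.trans hσF
          exact Or.inr ⟨ρ, ⟨hρ, hρF⟩,
            (visible_inf_iff hx (listTriangulation_le hρ) hρF).2 hvis, rfl⟩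
      · rintro (hσ | ⟨ρ, ⟨hρ, hρF⟩, hvis, rfl⟩)
        · exact ⟨Or.inl hσ.1, hσ.2⟩
        · exact ⟨Or.inr ⟨ρ, hρ, (visible_inf_iff hx (listTriangulation_le hρ) hρF).1 hvis, rfl⟩,
            sup_le hρF (Submodule.span_le.2 (by simpa using hx))⟩
    · rw [List.filter_cons_of_neg (by simpa using hx), ← ih, listTriangulation]
      ext σ
      constructor
      · rintro ⟨hσ | ⟨ρ, hρ, hvis, rfl⟩, hσF⟩
        · exact ⟨hσ, hσF⟩
        · exact absurd (hσF mem_sup_ray_self) hx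
      · exact fun hσ => ⟨Or.inl hσ.1, hσ.2⟩

open scoped Classical in
theorem lexTriangulation_subfamily_face {n : ℕ} (x : Fin n → E) {F : PointedCone ℝ E}
    (hF : F.IsFaceOf (PointedCone.hull ℝ (Set.range x))) :
    lexTriangulation (subfamily x {i | x i ∈ F}) = {σ ∈ lexTriangulation x | σ ≤ F} := by
  have hrange : {y | y ∈ (List.ofFn x).reverse} = Set.range x := by
    ext; simp [List.mem_ofFn]
  rw [lexTriangulation_eq_list, lexTriangulation_eq_list,
    listTriangulation_filter_face (by rwa [hrange]), ofFn_subfamily, List.filter_reverse,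
    List.ofFn_eq_map, List.filter_map]
  rfl

/-- The members of a triangulation contained in a face triangulate that face. -/
theorem IsTriangulation.face {X : Set E} {C F : PointedCone ℝ E} {S : Set (PointedCone ℝ E)}
    (hS : IsTriangulation X C S) (hF : F.IsFaceOf C) :
    IsTriangulation X F {σ ∈ S | σ ≤ F} where
  finite := hS.finite.subset (Set.sep_subset _ _)
  simplicial := fun σ hσ => hS.simplicial σ hσ.1
  face_mem := fun σ hσ τ hτ => ⟨hS.face_mem σ hσ.1 τ hτ, hτ.le.trans hσ.2⟩
  inter_face := fun σ hσ τ hτ => hS.inter_face σ hσ.1 τ hτ.1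
  cover := by
    refine Set.Subset.antisymm (Set.iUnion₂_subset fun σ hσ => hσ.2) fun z hz => ?_
    obtain ⟨σ, hσ, hzσ⟩ := hS.exists_mem (hF.le hz)
    have hface : (σ ⊓ F).IsFaceOf σ := by
      have := (PointedCone.IsFaceOf.refl σ).inf hF
      rwa [inf_eq_left.2 (hS.le hσ)] at this
    exact Set.mem_biUnion (show σ ⊓ F ∈ {σ ∈ S | σ ≤ F} from
      ⟨hS.face_mem σ hσ _ hface, inf_le_right⟩) ⟨hzσ, hz⟩

end Algebra

section Topology

variable {E : Type*} [NormedAddCommGroup E] [NormedSpace ℝ E] [FiniteDimensional ℝ E]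

theorem restriction_lexTriangulation_face {n : ℕ} (x : Fin n → E) {F : PointedCone ℝ E}
    (hF : F.IsFaceOf (PointedCone.hull ℝ (Set.range x))) :
    restriction (lexTriangulation x) F = lexTriangulation (subfamily x {i | x i ∈ F}) := by
  have h := isTriangulation_lexTriangulation x
  rw [lexTriangulation_subfamily_face x hF, h.restriction_eq (h.face hF) (Set.sep_subset _ _)]

end Topology

/-! ### Exchanging vectors -/

section Algebra

variable {E : Type*} [AddCommGroup E] [Module ℝ E] {C σ : PointedCone ℝ E} {a b : E}
  {V : Submodule ℝ E}

theorem visible_of_notMem (hCV : (C : Set E) ⊆ V) (hb : b ∉ V) (hσ : σ ≤ C) :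
    Visible C b σ := by
  refine (visible_iff hσ).2 ⟨fun h => hb (hCV h), fun y hy ε hε h => hb ?_⟩
  have h1 := V.sub_mem (hCV h) (hCV (hσ hy))
  rw [add_sub_cancel_left] at h1
  exact (V.smul_mem_iff hε.ne').1 h1

theorem mem_sup_ray_iff_of_notMem (hCV : (C : Set E) ⊆ V) (hb : b ∉ V) {y : E} (hy : y ∈ V)
    {t : ℝ} (ht : 0 ≤ t) : y + t • b ∈ C ⊔ PointedCone.hull ℝ {b} ↔ y ∈ C := by
  rw [mem_sup_ray]
  constructor
  · rintro ⟨y', hy', t', -, h⟩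
    exact (coeff_unique hb (hCV hy') hy h).2 ▸ hy'
  · exact fun h => ⟨y, h, t, ht, rfl⟩

/-- Enlarging both cones by a new dimension does not change visibility. -/
theorem visible_sup_ray_sup_ray_iff (hCV : (C : Set E) ⊆ V) (ha : a ∈ V) (hb : b ∉ V)
    (hσ : σ ≤ C) :
    Visible (C ⊔ PointedCone.hull ℝ {b}) a (σ ⊔ PointedCone.hull ℝ {b}) ↔ Visible C a σ := by
  rw [visible_iff hσ, visible_iff (sup_le_sup_right hσ _)]
  refine and_congr (not_congr ?_) ⟨fun h y hy ε hε => ?_, fun h z hz ε hε => ?_⟩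
  · simpa using mem_sup_ray_iff_of_notMem hCV hb ha (le_refl (0 : ℝ))
  · exact fun hmem => h y (le_sup_left (b := PointedCone.hull ℝ {b}) hy) ε hε
      (le_sup_left (b := PointedCone.hull ℝ {b}) hmem)
  · obtain ⟨y, hy, t, ht, rfl⟩ := mem_sup_ray.1 hz
    rw [add_right_comm, mem_sup_ray_iff_of_notMem hCV hb
      (V.add_mem (hCV (hσ hy)) (V.smul_mem ε ha)) ht]
    exact h y hy ε hε

theorem visible_sup_ray_iff (hCV : (C : Set E) ⊆ V) (ha : a ∈ V) (hb : b ∉ V)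
    (hσ : σ ≤ C) : Visible (C ⊔ PointedCone.hull ℝ {b}) a σ ↔ Visible C a σ := by
  refine ⟨fun h => ?_, fun h =>
    ((visible_sup_ray_sup_ray_iff hCV ha hb hσ).2 h).mono le_sup_left⟩
  rw [visible_iff (hσ.trans le_sup_left)] at h
  rw [visible_iff hσ]
  exact ⟨fun hmem => h.1 (le_sup_left (b := PointedCone.hull ℝ {b}) hmem), fun y hy ε hε hmem =>
    h.2 y hy ε hε (le_sup_left (b := PointedCone.hull ℝ {b}) hmem)⟩

theorem place_comm {T : Set (PointedCone ℝ E)} (hT : ∀ σ ∈ T, σ ≤ C) (hCV : (C : Set E) ⊆ V)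
    (ha : a ∈ V) (hb : b ∉ V) :
    place (C ⊔ PointedCone.hull ℝ {a}) (place C T a) b =
      place (C ⊔ PointedCone.hull ℝ {b}) (place C T b) a := by
  have hCaV : ((C ⊔ PointedCone.hull ℝ {a} : PointedCone ℝ E) : Set E) ⊆ V := by
    intro z hz
    obtain ⟨y, hy, t, -, rfl⟩ := mem_sup_ray.1 hz
    exact V.add_mem (hCV hy) (V.smul_mem t ha)
  ext τ
  constructor
  · rintro ((hτ | ⟨σ, hσ, hvis, rfl⟩) | ⟨ρ, hρ | ⟨σ, hσ, hvis, rfl⟩, -, rfl⟩)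
    · exact Or.inl (Or.inl hτ)
    · exact Or.inr ⟨σ, Or.inl hσ, (visible_sup_ray_iff hCV ha hb (hT σ hσ)).2 hvis, rfl⟩
    · exact Or.inl (Or.inr ⟨ρ, hρ, visible_of_notMem hCV hb (hT ρ hρ), rfl⟩)
    · exact Or.inr ⟨_, Or.inr ⟨σ, hσ, visible_of_notMem hCV hb (hT σ hσ), rfl⟩,
        (visible_sup_ray_sup_ray_iff hCV ha hb (hT σ hσ)).2 hvis, sup_right_comm _ _ _⟩
  · rintro ((hτ | ⟨σ, hσ, -, rfl⟩) | ⟨ρ, hρ | ⟨σ, hσ, -, rfl⟩, hvis, rfl⟩)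
    · exact Or.inl (Or.inl hτ)
    · exact Or.inr ⟨σ, Or.inl hσ,
        visible_of_notMem hCaV hb ((hT σ hσ).trans le_sup_left), rfl⟩
    · exact Or.inl (Or.inr ⟨ρ, hρ, (visible_sup_ray_iff hCV ha hb (hT ρ hρ)).1 hvis, rfl⟩)
    · exact Or.inr ⟨_, Or.inr ⟨σ, hσ,
        (visible_sup_ray_sup_ray_iff hCV ha hb (hT σ hσ)).1 hvis, rfl⟩,
        visible_of_notMem hCaV hb (sup_le_sup_right (hT σ hσ) _), sup_right_comm _ _ _⟩

theorem listTriangulation_swap {l : List E}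
    (hb : b ∉ Submodule.span ℝ {y | y ∈ a :: l}) :
    listTriangulation (b :: a :: l) = listTriangulation (a :: b :: l) := by
  simp only [listTriangulation, setOf_mem_cons, hull_insert]
  refine place_comm (V := Submodule.span ℝ {y | y ∈ a :: l}) (fun σ hσ => listTriangulation_le hσ)
    ?_ (Submodule.subset_span (by simp)) hb
  refine subset_trans (PointedCone.hull_le_span ℝ _) (Submodule.span_mono fun y hy => ?_)
  exact List.mem_cons_of_mem a hy

theorem listTriangulation_cons_congr {l l' : List E} (h : listTriangulation l = listTriangulation l')
    (hmem : ∀ y, y ∈ l ↔ y ∈ l') (x : E) :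
    listTriangulation (x :: l) = listTriangulation (x :: l') := by
  simp only [listTriangulation, h, hmem]

theorem listTriangulation_cons_append (l₁ l₂ : List E)
    (hb : b ∉ Submodule.span ℝ {y | y ∈ l₁ ++ l₂}) :
    listTriangulation (b :: (l₁ ++ l₂)) = listTriangulation (l₁ ++ b :: l₂) := by
  induction l₁ with
  | nil => rfl
  | cons a l₁ ih =>
    refine (listTriangulation_swap hb).trans ?_
    refine listTriangulation_cons_congr (ih fun h => hb (Submodule.span_mono (fun y hy => ?_) h))
      (fun y => ?_) a
    · exact List.mem_cons_of_mem a hy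
    · simp only [List.mem_cons, List.mem_append]
      tauto

theorem lexTriangulation_swap {n : ℕ} (x : Fin n → E) {i j : Fin n} (hij : (i : ℕ) + 1 = j)
    (hj : x j ∉ Submodule.span ℝ (firstGenerators x j)) :
    lexTriangulation x = lexTriangulation (x ∘ Equiv.swap i j) := by
  induction n with
  | zero => exact i.elim0
  | succ n ih =>
    have hin : i ≠ Fin.last n := by
      rintro rfl
      have := j.2
      simp only [Fin.val_last] at hij
      omega
    obtain ⟨i, rfl⟩ := Fin.exists_castSucc_eq.2 hin
    induction j using Fin.lastCases with
    | last =>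
      cases n with
      | zero => exact i.elim0
      | succ n =>
        obtain rfl : i = Fin.last n := by
          ext
          simpa using hij
        rw [lexTriangulation_eq_list, lexTriangulation_eq_list]
        simp only [List.ofFn_succ_last, List.reverse_append, List.reverse_cons, List.reverse_nil,
          List.nil_append, List.singleton_append, Function.comp_apply, Equiv.swap_apply_left,
          Equiv.swap_apply_right]
        have hfix : ∀ k : Fin n, Equiv.swap (Fin.last n).castSucc (Fin.last (n + 1))
            k.castSucc.castSucc = k.castSucc.castSucc := by
          intro k
          apply Equiv.swap_apply_of_ne_of_ne
          · exact fun h => k.castSucc_ne_last (Fin.castSucc_injective _ h)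
          · exact Fin.castSucc_ne_last _
        simp only [hfix]
        refine listTriangulation_swap fun h => hj (Submodule.span_mono ?_ h)
        intro y hy
        simp only [List.mem_cons, List.mem_reverse, List.mem_ofFn, Set.mem_ofPred_eq] at hy
        rcases hy with rfl | ⟨k, rfl⟩
        · exact ⟨_, by simp, rfl⟩
        · exact ⟨_, by simp, rfl⟩
    | cast j =>
      rw [Fin.val_castSucc, ← firstGenerators_init x j.2.le] at hj
      have hswap : Fin.init (x ∘ Equiv.swap i.castSucc j.castSucc) =
          Fin.init x ∘ Equiv.swap i j := by
        ext1 k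
        simp only [Fin.init, Function.comp_apply, Equiv.swap_apply_def, Fin.castSucc_inj]
        split_ifs <;> rfl
      have hlast : (x ∘ Equiv.swap i.castSucc j.castSucc) (Fin.last n) = x (Fin.last n) := by
        rw [Function.comp_apply, Equiv.swap_apply_of_ne_of_ne (Fin.castSucc_ne_last i).symm
          (Fin.castSucc_ne_last j).symm]
      rw [lexTriangulation_succ, lexTriangulation_succ, hswap, hlast,
        ← ih (Fin.init x) (by simpa using hij) hj, EquivLike.range_comp]

theorem notMem_span_of_coneDim_lt {n : ℕ} (x : Fin n → E) (j : Fin n)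
    (h : coneDim (initialCone x j) < coneDim (initialCone x (j + 1))) :
    x j ∉ Submodule.span ℝ (firstGenerators x j) := by
  intro hj
  refine h.ne ?_
  rw [coneDim, coneDim, initialCone, initialCone, span_hull, span_hull, firstGenerators_succ,
    Submodule.span_insert_eq_span hj]

/-! ### The lexicographically smallest basis -/

/-- The index `i` is a jump of the family `x` if `x i` is not a linear combination of the preceding
vectors. -/
def IsJump {n : ℕ} (x : Fin n → E) (i : Fin n) : Prop :=
  x i ∉ Submodule.span ℝ (firstGenerators x i)

theorem isJump_init {n : ℕ} (x : Fin (n + 1) → E) (i : Fin n) :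
    IsJump (Fin.init x) i ↔ IsJump x i.castSucc := by
  rw [IsJump, IsJump, Fin.val_castSucc, firstGenerators_init x i.2.le]
  rfl

open scoped Classical in
/-- The vectors at the jumps can be placed first, by moving each of them in front of the preceding
other vectors. -/
theorem lexTriangulation_eq_jumps_first {n : ℕ} (x : Fin n → E) :
    lexTriangulation x = listTriangulation
      ((((List.finRange n).filter (fun i => ¬ IsJump x i)).map x).reverse ++
        (((List.finRange n).filter (fun i => IsJump x i)).map x).reverse) := by
  induction n with
  | zero => simp [lexTriangulation, listTriangulation]
  | succ n ih =>
    have hfilter : ∀ (p : Fin (n + 1) → Prop) [DecidablePred p],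
        ((((List.finRange n).map Fin.castSucc).filter (fun i => p i)).map x) =
          ((List.finRange n).filter (fun i => p i.castSucc)).map (Fin.init x) := by
      intro p _
      rw [List.filter_map, List.map_map]
      rfl
    specialize ih (Fin.init x)
    simp only [isJump_init] at ih
    set N := (((List.finRange n).filter (fun i => ¬ IsJump x i.castSucc)).map (Fin.init x)).reverse
      with hN
    set G := (((List.finRange n).filter (fun i => IsJump x i.castSucc)).map (Fin.init x)).reverse
      with hG
    have hmem : {y | y ∈ N ++ G} = Set.range (Fin.init x) := by
      ext y
      simp only [hN, hG, List.mem_append, List.mem_reverse, List.mem_map, List.mem_filter,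
        List.mem_finRange, decide_eq_true_eq, true_and, Set.mem_ofPred_eq, Set.mem_range]
      constructor
      · rintro (⟨i, -, rfl⟩ | ⟨i, -, rfl⟩) <;> exact ⟨i, rfl⟩
      · rintro ⟨i, rfl⟩
        by_cases hi : IsJump x i.castSucc
        · exact Or.inr ⟨i, hi, rfl⟩
        · exact Or.inl ⟨i, hi, rfl⟩
    have hcons : lexTriangulation x = listTriangulation (x (Fin.last n) :: (N ++ G)) := by
      rw [lexTriangulation_succ, listTriangulation, hmem, ih]
    rw [hcons, List.finRange_succ_last, List.filter_append, List.filter_append, List.map_append,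
      List.map_append, hfilter, hfilter, List.reverse_append, List.reverse_append, ← hN, ← hG]
    by_cases hlast : IsJump x (Fin.last n)
    · have hspan : x (Fin.last n) ∉ Submodule.span ℝ {y | y ∈ N ++ G} := by
        rw [IsJump, Fin.val_last, ← firstGenerators_init x le_rfl, firstGenerators_self] at hlast
        rwa [hmem]
      rw [listTriangulation_cons_append N G hspan]
      simp [hlast]
    · simp [hlast]

theorem linearIndependent_of_notMem_span_lt {r : ℕ} {v : Fin r → E}
    (h : ∀ k, v k ∉ Submodule.span ℝ (v '' {j | j < k})) : LinearIndependent ℝ v := by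
  induction r with
  | zero => exact linearIndependent_empty_type
  | succ r ih =>
    refine linearIndependent_finSucc'.2 ⟨ih fun k hk => h k.castSucc ?_, fun hk => h (Fin.last r) ?_⟩
    · refine Submodule.span_mono ?_ hk
      rintro _ ⟨j, hj, rfl⟩
      exact ⟨j.castSucc, hj, rfl⟩
    · refine Submodule.span_mono ?_ hk
      rintro _ ⟨j, rfl⟩
      exact ⟨j.castSucc, Fin.castSucc_lt_last j, rfl⟩

/-- The vectors at the jumps before position `m` span all vectors before position `m`. -/
theorem firstGenerators_subset_span_jumps {n : ℕ} (x : Fin n → E) (m : ℕ) :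
    firstGenerators x m ⊆
      (Submodule.span ℝ (x '' {i | (i : ℕ) < m ∧ IsJump x i}) : Set E) := by
  induction m with
  | zero =>
    rintro _ ⟨i, hi, rfl⟩
    exact absurd hi (Nat.not_lt_zero _)
  | succ m ih =>
    have hle : Submodule.span ℝ (firstGenerators x m) ≤
        Submodule.span ℝ (x '' {i | (i : ℕ) < m + 1 ∧ IsJump x i}) := by
      refine Submodule.span_le.2 (ih.trans (Submodule.span_mono (Set.image_mono ?_)))
      exact fun i hi => ⟨hi.1.trans m.lt_succ_self, hi.2⟩
    rintro _ ⟨i, hi, rfl⟩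
    rcases (Nat.lt_succ_iff.1 hi).lt_or_eq with hlt | rfl
    · exact hle (Submodule.subset_span ⟨i, hlt, rfl⟩)
    · by_cases hJ : IsJump x i
      · exact Submodule.subset_span ⟨i, ⟨hi, hJ⟩, rfl⟩
      · exact hle (not_not.1 hJ)

theorem linearIndependent_comp_of_isJump {n r : ℕ} {x : Fin n → E} {s : Fin r → Fin n}
    (hs : StrictMono s) (hJ : ∀ k, IsJump x (s k)) : LinearIndependent ℝ (x ∘ s) := by
  refine linearIndependent_of_notMem_span_lt fun k hk => hJ k (Submodule.span_mono ?_ hk)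
  rintro _ ⟨j, hj, rfl⟩
  exact ⟨s j, hs hj, rfl⟩

/-- The increasing enumeration of the jumps is lexicographically minimal among the independent
index vectors: where another one first falls below it, it uses an index that is not a jump. -/
theorem toLex_le_of_range_eq_jumps {n r : ℕ} {x : Fin n → E} {s t : Fin r → Fin n}
    (hs : StrictMono s) (hrange : Set.range s = {i | IsJump x i}) (ht : StrictMono t)
    (hli : LinearIndependent ℝ (x ∘ t)) : toLex s ≤ toLex t := by
  by_contra hlt
  obtain ⟨k, hk, hlt⟩ := not_le.1 hlt
  change t k < s k at hlt
  have hk : ∀ j < k, t j = s j := hk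
  -- The jumps up to `t k` are `s j = t j` for `j < k`.
  have hjump : ∀ i ≤ t k, IsJump x i → ∃ j < k, t j = i := by
    intro i hi hJ
    obtain ⟨j, rfl⟩ : i ∈ Set.range s := hrange ▸ hJ
    have hjk : j < k := hs.lt_iff_lt.1 (hi.trans_lt hlt)
    exact ⟨j, hjk, hk j hjk⟩
  have hnot : ¬ IsJump x (t k) := by
    intro hJ
    obtain ⟨j, hjk, hj⟩ := hjump _ le_rfl hJ
    exact hjk.ne (ht.injective hj)
  have hmem : (x ∘ t) k ∈ Submodule.span ℝ ((x ∘ t) '' {j | j < k}) := by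
    refine Submodule.span_le.2 ((firstGenerators_subset_span_jumps x (t k)).trans
      (Submodule.span_mono ?_)) (not_not.1 hnot)
    rintro _ ⟨i, ⟨hi, hJ⟩, rfl⟩
    obtain ⟨j, hjk, rfl⟩ := hjump i (Fin.le_def.2 hi.le) hJ
    exact ⟨j, hjk, rfl⟩
  exact (hli.notMem_span_image (by simp)) hmem

theorem exists_jump_enumeration {n : ℕ} (x : Fin n → E) :
    ∃ s : Fin (coneDim (PointedCone.hull ℝ (Set.range x))) → Fin n,
      StrictMono s ∧ Set.range s = {i | IsJump x i} := by
  classical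
  set J : Finset (Fin n) := Finset.univ.filter (IsJump x) with hJ
  have hrangeJ : Set.range (J.orderEmbOfFin rfl) = {i | IsJump x i} := by
    rw [Finset.range_orderEmbOfFin]
    simp [hJ]
  have hli : LinearIndependent ℝ (x ∘ J.orderEmbOfFin rfl) :=
    linearIndependent_comp_of_isJump (J.orderEmbOfFin rfl).strictMono fun k => by
      have : J.orderEmbOfFin rfl k ∈ Set.range (J.orderEmbOfFin rfl) := ⟨k, rfl⟩
      rwa [hrangeJ] at this
  have hspan : Submodule.span ℝ (Set.range (x ∘ J.orderEmbOfFin rfl)) =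
      Submodule.span ℝ (Set.range x) := by
    refine le_antisymm (Submodule.span_mono (Set.range_comp_subset_range _ _))
      (Submodule.span_le.2 ?_)
    rw [Set.range_comp, hrangeJ, ← firstGenerators_self x]
    refine (firstGenerators_subset_span_jumps x n).trans (Submodule.span_mono (Set.image_mono ?_))
    exact fun i hi => hi.2
  have hcard : J.card = coneDim (PointedCone.hull ℝ (Set.range x)) := by
    rw [coneDim, span_hull, ← hspan, finrank_span_eq_card hli, Fintype.card_fin]
  refine ⟨J.orderEmbOfFin hcard, (J.orderEmbOfFin hcard).strictMono, ?_⟩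
  rw [Finset.range_orderEmbOfFin]
  simp [hJ]

theorem lexTriangulation_eq_append {n r : ℕ} (x : Fin n → E) {s : Fin r → Fin n}
    (hs : StrictMono s) (hrange : Set.range s = {i | IsJump x i}) :
    lexTriangulation x = lexTriangulation (Fin.append (x ∘ s) (subfamily x (Set.range s)ᶜ)) := by
  classical
  have hofFn : List.ofFn s = (List.finRange n).filter (fun i => IsJump x i) := by
    refine List.Pairwise.eq_of_mem_iff (r := (· < ·)) (List.pairwise_ofFn.2 fun _ _ h => hs h)
      ((List.pairwise_lt_finRange n).filter _) fun i => ?_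
    have := Set.ext_iff.1 hrange i
    simpa [List.mem_ofFn] using this
  rw [lexTriangulation_eq_jumps_first, lexTriangulation_eq_list, List.ofFn_fin_append,
    ofFn_subfamily, List.reverse_append, ← List.map_ofFn, hofFn, hrange]
  congr! 5
  funext i
  simp

end Algebra

end LexTriangulation

theorem proposition2p1 {d n : ℕ} (x : Fin n → (Fin d → ℝ)) :
    -- (1) characterization among all sets of cones
    (∀ S : Set (PointedCone ℝ (Fin d → ℝ)),
      (LexTriangulation.IsTriangulation (Set.range x) (PointedCone.hull ℝ (Set.range x)) S ∧
        ∀ i : ℕ, 1 ≤ i → i ≤ n →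
          LexTriangulation.RestrictsToTriangulation S
            (LexTriangulation.firstGenerators x i) (LexTriangulation.initialCone x i)) ↔
      S = LexTriangulation.lexTriangulation x) ∧
    -- (2) restriction to faces
    (∀ F : PointedCone ℝ (Fin d → ℝ), F.IsFaceOf (PointedCone.hull ℝ (Set.range x)) →
      LexTriangulation.restriction (LexTriangulation.lexTriangulation x) F =
        LexTriangulation.lexTriangulation (LexTriangulation.subfamily x {i | x i ∈ F})) ∧
    -- (3) swapping two consecutive generators, the second of which increases the dimension
    (∀ i j : Fin n, (i : ℕ) + 1 = j →
      LexTriangulation.coneDim (LexTriangulation.initialCone x j) <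
        LexTriangulation.coneDim (LexTriangulation.initialCone x (j + 1)) →
      LexTriangulation.lexTriangulation x =
        LexTriangulation.lexTriangulation (x ∘ Equiv.swap i j)) ∧
    -- (4) placing the lexicographically smallest independent subset of full rank first
    (∃ s ∈ LexTriangulation.independentIndexVectors x
        (LexTriangulation.coneDim (PointedCone.hull ℝ (Set.range x))),
      (∀ t ∈ LexTriangulation.independentIndexVectors x
        (LexTriangulation.coneDim (PointedCone.hull ℝ (Set.range x))), toLex s ≤ toLex t) ∧
      LexTriangulation.lexTriangulation x =
        LexTriangulation.lexTriangulation
          (Fin.append (x ∘ s) (LexTriangulation.subfamily x (Set.range s)ᶜ))) := by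
  refine ⟨LexTriangulation.eq_lexTriangulation_iff x,
    fun F hF => LexTriangulation.restriction_lexTriangulation_face x hF,
    fun i j hij h => LexTriangulation.lexTriangulation_swap x hij
      (LexTriangulation.notMem_span_of_coneDim_lt x j h), ?_⟩
  obtain ⟨s, hs, hrange⟩ := LexTriangulation.exists_jump_enumeration x
  exact ⟨s, ⟨hs, LexTriangulation.linearIndependent_comp_of_isJump hs fun k =>
      Set.ext_iff.1 hrange (s k) |>.1 ⟨k, rfl⟩⟩,
    fun t ht => LexTriangulation.toLex_le_of_range_eq_jumps hs hrange ht.1 ht.2,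
    LexTriangulation.lexTriangulation_eq_append x hs hrange⟩
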